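/- Let $V$ be a finite-dimensional real vector space and let $F$ be a Hausdorff real topological vector space. Let $\mathrm{Conv}(V)$ be the set of all convex, lower semi-continuous functions $f:V\to(-\infty,\infty]$ that are not identically $+\infty$, and let $\mathrm{Conv}(V,\mathbb{R})\subset\mathrm{Conv}(V)$ be the subset of finite-valued functions. A sequence $(f_j)_j$ in $\mathrm{Conv}(V)$ epi-converges to $f\in\mathrm{Conv}(V)$ if for every $x\in V$ one has $f(x)\le\liminf_{j\to\infty}f_j(x_j)$ for every sequence $x_j\to x$, and there is a sequence $x_j\to x$ with $f(x)=\lim_{j\to\infty}f_j(x_j)$. Let $C\subset\mathrm{Conv}(V)$ be a cone containing $\mathrm{Conv}(V,\mathbb{R})$; here $C$ is called a cone if $f+th\in C$ for all $f,h\in C$ and $t>0$ such that $f+th$ is not identically $+\infty$. Let $\mathrm{VConv}(C;V,F)$ be the real vector space of all maps $\mu:C\to F$ such that 1. $\mu$ is a valuation: $\mu(f)+\mu(h)=\mu(\max(f,h))+\mu(\min(f,h))$ for all $f,h\in C$ such that the pointwise maximum and minimum belong to $C$; 2. $\mu$ is continuous with respect to epi-convergence: $\mu(f_j)\to\mu(f)$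 whenever $f_j,f\in C$ and $(f_j)_j$ epi-converges to $f$; 3. $\mu$ is dually epi-translation invariant: $\mu(f+\lambda+c)=\mu(f)$ for all $f\in C$, $\lambda\in V^*$, $c\in\mathbb{R}$ with $f+\lambda+c\in C$. For an integer $k\ge 0$ let $\mathrm{VConv}_k(C;V,F)$ be the subspace of those $\mu\in\mathrm{VConv}(C;V,F)$ that are $k$-homogeneous, i.e. $\mu(tf)=t^k\mu(f)$ for all $f\in C$ and $t>0$ with $tf\in C$. Then $$\mathrm{VConv}(C;V,F)=\bigoplus_{k=0}^{\dim V}\mathrm{VConv}_k(C;V,F).$$ -/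

import Mathlib

open Filter Topology

noncomputable section

namespace ConvVal

/-- `Conv(V)`: the convex, lower semi-continuous functions `f : V → (-∞, ∞]` that are not
identically `+∞`. In `EReal` one has `0 * ⊤ = 0`. -/
def Conv (V : Type*) [AddCommGroup V] [Module ℝ V] [TopologicalSpace V] : Set (V → EReal) :=
  {f | (∀ x, f x ≠ ⊥) ∧
    (∀ x y : V, ∀ t ∈ Set.Icc (0 : ℝ) 1,
      f (t • x + (1 - t) • y) ≤ (t : EReal) * f x + ((1 - t : ℝ) : EReal) * f y) ∧
    LowerSemicontinuous f ∧
    ∃ x, f x ≠ ⊤}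

/-- `Conv(V, ℝ)`: the finite-valued elements of `Conv(V)`. -/
def ConvFinite (V : Type*) [AddCommGroup V] [Module ℝ V] [TopologicalSpace V] :
    Set (V → EReal) :=
  {f | f ∈ Conv V ∧ ∀ x, f x < ⊤}

/-- The pointwise product `t f`. -/
def scale {V : Type*} (t : ℝ) (f : V → EReal) : V → EReal :=
  fun x => (t : EReal) * f x

/-- `C` is a cone: `f + t h ∈ C` for all `f, h ∈ C` and `t > 0`, whenever the sum is not
identically `+∞`. With this proviso `Conv V` itself is a cone; a subset of `Conv V` that is closed
under `f + t h` without any proviso is a cone as well. -/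
def IsCone {V : Type*} (C : Set (V → EReal)) : Prop :=
  ∀ f ∈ C, ∀ h ∈ C, ∀ t : ℝ, 0 < t → (∃ x, (f + scale t h) x ≠ ⊤) → f + scale t h ∈ C

/-- Epi-convergence of a sequence of extended real valued functions. -/
def EpiConverges {V : Type*} [TopologicalSpace V] (f : ℕ → V → EReal) (g : V → EReal) : Prop :=
  ∀ x : V,
    (∀ u : ℕ → V, Tendsto u atTop (𝓝 x) → g x ≤ liminf (fun j => f j (u j)) atTop) ∧
    ∃ u : ℕ → V, Tendsto u atTop (𝓝 x) ∧ Tendsto (fun j => f j (u j)) atTop (𝓝 (g x))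

section Valuations

variable {V F : Type*}

/-- `μ` is a valuation on `C`; `⊔` and `⊓` are the pointwise maximum and minimum. -/
def IsValuation [Add F] {C : Set (V → EReal)} (μ : C → F) : Prop :=
  ∀ (f h : C) (hmax : (f : V → EReal) ⊔ h ∈ C) (hmin : (f : V → EReal) ⊓ h ∈ C),
    μ f + μ h = μ ⟨(f : V → EReal) ⊔ h, hmax⟩ + μ ⟨(f : V → EReal) ⊓ h, hmin⟩

/-- Continuity with respect to epi-convergence. Epi-convergence on `Conv V` is the convergence of
sequences in a metrizable topology, so this is continuity for the induced topology on `C`. -/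
def IsEpiContinuous [TopologicalSpace V] [TopologicalSpace F] {C : Set (V → EReal)}
    (μ : C → F) : Prop :=
  ∀ (f : ℕ → C) (g : C), EpiConverges (fun j => (f j : V → EReal)) g →
    Tendsto (fun j => μ (f j)) atTop (𝓝 (μ g))

/-- Invariance of `μ` under the addition of (continuous) linear functionals and constants. -/
def IsDuallyEpiTranslationInvariant [AddCommGroup V] [Module ℝ V] [TopologicalSpace V]
    {C : Set (V → EReal)} (μ : C → F) : Prop :=
  ∀ (f : C) (l : V →L[ℝ] ℝ) (c : ℝ)
    (hf : (fun x => (f : V → EReal) x + ((l x + c : ℝ) : EReal)) ∈ C),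
    μ ⟨fun x => (f : V → EReal) x + ((l x + c : ℝ) : EReal), hf⟩ = μ f

/-- `μ` is homogeneous of degree `k`. -/
def IsHomogeneous [AddCommGroup F] [Module ℝ F] {C : Set (V → EReal)} (k : ℕ)
    (μ : C → F) : Prop :=
  ∀ (f : C) (t : ℝ), 0 < t → ∀ hf : scale t (f : V → EReal) ∈ C,
    μ ⟨scale t (f : V → EReal), hf⟩ = t ^ k • μ f

end Valuations

/-- `VConv(C; V, F)`: the real vector space of continuous, dually epi-translation invariant
valuations `C → F`, with pointwise operations. -/
def VConv {V : Type*} [AddCommGroup V] [Module ℝ V] [TopologicalSpace V]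
    (C : Set (V → EReal)) (F : Type*) [AddCommGroup F] [Module ℝ F] [TopologicalSpace F]
    [IsTopologicalAddGroup F] [ContinuousSMul ℝ F] : Submodule ℝ (C → F) where
  carrier := {μ | IsValuation μ ∧ IsEpiContinuous μ ∧ IsDuallyEpiTranslationInvariant μ}
  zero_mem' := by
    refine ⟨fun f h _ _ => ?_, fun f g _ => ?_, fun f l c _ => rfl⟩
    · simp
    · exact tendsto_const_nhds
  add_mem' := by
    rintro μ ν ⟨h1, h2, h3⟩ ⟨k1, k2, k3⟩
    refine ⟨fun f h hmax hmin => ?_, fun f g hfg => ?_, fun f l c hf => ?_⟩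
    · have a := h1 f h hmax hmin
      have b := k1 f h hmax hmin
      simp only [Pi.add_apply]
      rw [add_add_add_comm, a, b, add_add_add_comm]
    · exact (h2 f g hfg).add (k2 f g hfg)
    · simp only [Pi.add_apply]
      rw [h3 f l c hf, k3 f l c hf]
  smul_mem' := by
    rintro r μ ⟨h1, h2, h3⟩
    refine ⟨fun f h hmax hmin => ?_, fun f g hfg => ?_, fun f l c hf => ?_⟩
    · simp only [Pi.smul_apply]
      rw [← smul_add, h1 f h hmax hmin, smul_add]
    · exact (h2 f g hfg).const_smul r
    · simp only [Pi.smul_apply]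
      rw [h3 f l c hf]

/-- `VConv_k(C; V, F)`: the subspace of `k`-homogeneous elements of `VConv(C; V, F)`. -/
def VConvHom {V : Type*} [AddCommGroup V] [Module ℝ V] [TopologicalSpace V]
    (C : Set (V → EReal)) (F : Type*) [AddCommGroup F] [Module ℝ F] [TopologicalSpace F]
    [IsTopologicalAddGroup F] [ContinuousSMul ℝ F] (k : ℕ) : Submodule ℝ (VConv C F) where
  carrier := {μ | IsHomogeneous k (μ : C → F)}
  zero_mem' := by
    intro f t _ hf
    simp
  add_mem' := by
    intro μ ν h1 h2 f t ht hf
    have a := h1 f t ht hf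
    have b := h2 f t ht hf
    simp only [Submodule.coe_add, Pi.add_apply, smul_add]
    rw [a, b]
  smul_mem' := by
    intro r μ h1 f t ht hf
    have a := h1 f t ht hf
    simp only [Submodule.coe_smul, Pi.smul_apply]
    rw [a, smul_comm]

end ConvVal

end

/-!
For every `f ∈ C` the function `t ↦ μ (t f)` is a polynomial on `(0, ∞)` of degree at most
`n = dim V`. Its coefficients are fixed linear combinations of `μ f, μ (2 f), …, μ ((n + 1) f)`
(inversion of a Vandermonde matrix), so they are themselves continuous invariant valuations in `f`,
and they are homogeneous of the right degrees. Uniqueness of the coefficients gives independence.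

As an increasing sequence of continuous functions epi-converges to its pointwise limit, and every
element of `Conv V` is the limit of an increasing sequence of finite maxima of affine functions
(`Conv.exists_approx`), polynomiality need only be shown for such maxima. There it follows from the
valuation property and affine invariance alone, and continuity merely turns vanishing iterated
differences into genuine polynomials (`IsPolyLT.eq_sum`). Two ingredients are used.

* A maximum of `m + 1` affine functions has degree at most `m` (`isPolyLT_partialSups`). This is a
  form, in terms of pointwise maxima, of McMullen's dissection of a dilated simplex `(s + t) T` into
  products of faces of `s T` and `t T`. With `uᵣ = max (S₀, …, Sᵣ)` and `wᵣ = max (Sᵣ, …, Sₘ)` it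
  expresses `μ ((s + t) uₘ)` through the values `μ (s uᵣ + t wᵣ)` and `μ (s uᵣ + t wᵣ₊₁)`, and
  induction applies to the valuations `μ (· + t w)`. The `Sᵢ` may be arbitrary affine functions.
* Maxima of more than `n + 1` affine functions reduce to maxima of fewer
  (`IsMaxAffine.induction`). The linear parts of `n + 2` affine functions are affinely dependent,
  which, up to sign, yields a Radon-type inequality
  `∑ i ∈ I, cᵢ Sᵢ ≤ ∑ i ∈ J, |cᵢ| Sᵢ` with `I`, `J` disjoint, `cᵢ > 0` on `I` and equal total
  weights. If `I` is a singleton, its function is redundant in the maximum; otherwise two functions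
  of `I` are merged by inserting their weighted mean (`foldr_sup_induction`). That an inequality
  suffices here, rather than an equality, is what excludes the degree `n + 1` that occurs for convex
  bodies in dimension `n + 1`.
-/

namespace ConvVal

open scoped NNReal

/-! ### Functions on the half-line annihilated by iterated differences -/

section Differences

variable {F : Type*} [AddCommGroup F]

/-- `φ : [0, ∞) → F` is a polynomial of degree `< m` in the sense of Fréchet: every `m`-fold
iterated difference of `φ`, with arbitrary steps, vanishes. -/
def IsPolyLT : ℕ → (ℝ≥0 → F) → Prop
  | 0, φ => φ = 0
  | m + 1, φ => ∀ t : ℝ≥0, IsPolyLT m (fwdDiff t φ)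

lemma IsPolyLT.add : ∀ {m : ℕ} {φ ψ : ℝ≥0 → F}, IsPolyLT m φ → IsPolyLT m ψ →
    IsPolyLT m (φ + ψ)
  | 0, φ, ψ, h, k => by
    have h' : φ = 0 := h
    have k' : ψ = 0 := k
    change φ + ψ = 0
    rw [h', k', add_zero]
  | m + 1, φ, ψ, h, k => fun t => by
    rw [fwdDiff_add]
    exact (h t).add (k t)

lemma IsPolyLT.neg : ∀ {m : ℕ} {φ : ℝ≥0 → F}, IsPolyLT m φ → IsPolyLT m (-φ)
  | 0, φ, h => by
    have h' : φ = 0 := h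
    change -φ = 0
    rw [h', neg_zero]
  | m + 1, φ, h => fun t => by
    have : fwdDiff t (-φ) = -fwdDiff t φ := by
      ext s
      simp only [fwdDiff, Pi.neg_apply]
      abel
    rw [this]
    exact (h t).neg

lemma IsPolyLT.sub {m : ℕ} {φ ψ : ℝ≥0 → F} (h : IsPolyLT m φ) (k : IsPolyLT m ψ) :
    IsPolyLT m (φ - ψ) := by
  rw [sub_eq_add_neg]
  exact h.add k.neg

lemma isPolyLT_zero : ∀ m : ℕ, IsPolyLT m (0 : ℝ≥0 → F)
  | 0 => rfl
  | m + 1 => fun t => by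
    have : fwdDiff t (0 : ℝ≥0 → F) = 0 := by
      ext s
      simp [fwdDiff]
    rw [this]
    exact isPolyLT_zero m

lemma IsPolyLT.succ : ∀ {m : ℕ} {φ : ℝ≥0 → F}, IsPolyLT m φ → IsPolyLT (m + 1) φ
  | 0, φ, h => by
    have h' : φ = 0 := h
    rw [h']
    exact isPolyLT_zero 1
  | m + 1, φ, h => fun t => (h t).succ

lemma IsPolyLT.mono {m k : ℕ} {φ : ℝ≥0 → F} (h : IsPolyLT m φ) (hmk : m ≤ k) :
    IsPolyLT k φ := by
  induction hmk with
  | refl => exact h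
  | step _ ih => exact ih.succ

lemma isPolyLT_const (c : F) {m : ℕ} (hm : 1 ≤ m) : IsPolyLT m (fun _ : ℝ≥0 => c) := by
  refine IsPolyLT.mono (m := 1) (fun t => ?_) hm
  change fwdDiff t _ = 0
  ext s
  simp [fwdDiff]

lemma IsPolyLT.iterate_fwdDiff (t : ℝ≥0) :
    ∀ {m : ℕ} {φ : ℝ≥0 → F}, IsPolyLT m φ → ∀ k, m ≤ k → (fwdDiff t)^[k] φ = 0
  | 0, φ, h, k, _ => by
    have h' : φ = 0 := h
    rw [h']
    induction k with
    | zero => rfl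
    | succ k ih =>
      rw [Function.iterate_succ_apply]
      have : fwdDiff t (0 : ℝ≥0 → F) = 0 := by
        ext s
        simp [fwdDiff]
      rw [this, ih (Nat.zero_le _)]
  | m + 1, φ, h, k, hk => by
    obtain ⟨k, rfl⟩ : ∃ j, k = j + 1 := ⟨k - 1, by omega⟩
    rw [Function.iterate_succ_apply]
    exact (h t).iterate_fwdDiff t k (by omega)

end Differences

/-! ### Valuations on finite convex functions and maxima of affine functions -/

section Finite

variable {V : Type*} [NormedAddCommGroup V] [NormedSpace ℝ V]

/-- The finite convex functions on `V`. In finite dimension continuity is automatic; it is kept as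
part of the definition, being immediate for all functions that occur. -/
def IsFinConv (f : V → ℝ) : Prop := ConvexOn ℝ Set.univ f ∧ Continuous f

variable (V) in
/-- The vector space of continuous affine functions on `V`. -/
def affineFun : Submodule ℝ (V → ℝ) where
  carrier := {a | ∃ (l : V →L[ℝ] ℝ) (c : ℝ), a = fun x => l x + c}
  zero_mem' := ⟨0, 0, by ext; simp⟩
  add_mem' := by
    rintro _ _ ⟨l, c, rfl⟩ ⟨l', c', rfl⟩
    exact ⟨l + l', c + c', by ext x; simp only [Pi.add_apply, add_apply]; ring⟩
  smul_mem' := by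
    rintro r _ ⟨l, c, rfl⟩
    exact ⟨r • l, r * c, by
      ext x
      simp only [Pi.smul_apply, smul_apply, smul_eq_mul]; ring⟩

lemma isFinConv_of_mem_affineFun {a : V → ℝ} (ha : a ∈ affineFun V) : IsFinConv a := by
  obtain ⟨l, c, rfl⟩ := ha
  exact ⟨(l.toLinearMap.convexOn convex_univ).add_const c, by fun_prop⟩

lemma IsFinConv.add {f g : V → ℝ} (hf : IsFinConv f) (hg : IsFinConv g) : IsFinConv (f + g) :=
  ⟨hf.1.add hg.1, hf.2.add hg.2⟩

lemma IsFinConv.sup {f g : V → ℝ} (hf : IsFinConv f) (hg : IsFinConv g) : IsFinConv (f ⊔ g) :=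
  ⟨hf.1.sup hg.1, hf.2.sup hg.2⟩

lemma IsFinConv.smul {f : V → ℝ} (hf : IsFinConv f) (t : ℝ≥0) : IsFinConv (t • f) :=
  ⟨hf.1.smul t.2, hf.2.const_smul (t : ℝ)⟩

lemma isFinConv_partialSups {f : ℕ → V → ℝ} (hf : ∀ i, IsFinConv (f i)) (m : ℕ) :
    IsFinConv (partialSups f m) := by
  induction m with
  | zero => simpa using hf 0
  | succ m ih =>
    rw [partialSups_add_one]
    exact ih.sup (hf _)

lemma nnreal_smul_mem_affineFun {a : V → ℝ} (ha : a ∈ affineFun V) (t : ℝ≥0) :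
    t • a ∈ affineFun V :=
  (affineFun V).smul_mem (t : ℝ) ha

variable {F : Type*} [AddCommGroup F]

/-- `Z` restricts to a valuation on the finite convex functions, invariant under the addition of
affine functions. The values of `Z` elsewhere are irrelevant. -/
structure IsAffineInvVal (Z : (V → ℝ) → F) : Prop where
  val : ∀ f g, IsFinConv f → IsFinConv g → IsFinConv (f ⊓ g) →
    Z f + Z g = Z (f ⊔ g) + Z (f ⊓ g)
  inv : ∀ f, IsFinConv f → ∀ a ∈ affineFun V, Z (f + a) = Z f

/-- Translating the argument by a fixed finite convex function gives such a valuation again. This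
is what makes mixed expressions such as `Z (s • f + t • g)` accessible to induction. -/
lemma IsAffineInvVal.comp_add {Z : (V → ℝ) → F} (hZ : IsAffineInvVal Z) {g : V → ℝ}
    (hg : IsFinConv g) : IsAffineInvVal (fun f => Z (f + g)) where
  val f h hf hh hfh := by
    have := hZ.val (f + g) (h + g) (hf.add hg) (hh.add hg)
      (by rw [← inf_add]; exact hfh.add hg)
    rwa [← sup_add, ← inf_add] at this
  inv f hf a ha := by
    have := hZ.inv (f + g) (hf.add hg) a ha
    simpa only [add_right_comm] using this

/-- Precomposition with a scaling gives such a valuation again. -/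
lemma IsAffineInvVal.comp_smul {Z : (V → ℝ) → F} (hZ : IsAffineInvVal Z) (t : ℝ≥0) :
    IsAffineInvVal (fun f => Z (t • f)) where
  val f h hf hh hfh := by
    have e1 : t • (f ⊔ h) = t • f ⊔ t • h := by
      ext x; simp [NNReal.smul_def, mul_max_of_nonneg]
    have e2 : t • (f ⊓ h) = t • f ⊓ t • h := by
      ext x; simp [NNReal.smul_def, mul_min_of_nonneg]
    have := hZ.val (t • f) (t • h) (hf.smul t) (hh.smul t) (by rw [← e2]; exact hfh.smul t)
    rwa [← e1, ← e2] at this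
  inv f hf a ha := by
    simp only [smul_add]
    exact hZ.inv _ (hf.smul t) _ (nnreal_smul_mem_affineFun ha t)

end Finite

/-! ### A dissection of `(s + t) f` for a maximum `f` of affine functions -/

section Dissection

variable {V : Type*}

lemma exists_partialSups_apply_eq (S : ℕ → V → ℝ) (m : ℕ) (x : V) :
    ∃ a ≤ m, partialSups S m x = S a x := by
  rw [Pi.partialSups_apply, partialSups_eq_sup'_range]
  obtain ⟨a, ha, h⟩ := Finset.exists_mem_eq_sup' Finset.nonempty_range_add_one (fun i => S i x)
  exact ⟨a, by simpa [Nat.lt_succ_iff] using ha, h⟩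

/-- The maximum of `S r, …, S m`. -/
def tailSup (S : ℕ → V → ℝ) (m r : ℕ) : V → ℝ := partialSups (fun i => S (r + i)) (m - r)

lemma tailSup_self (S : ℕ → V → ℝ) (m : ℕ) : tailSup S m m = S m := by
  simp [tailSup]

lemma le_tailSup (S : ℕ → V → ℝ) {m r i : ℕ} (hri : r ≤ i) (him : i ≤ m) :
    S i ≤ tailSup S m r := by
  have := le_partialSups_of_le (fun i => S (r + i)) (i := i - r) (j := m - r) (by omega)
  simp only [Nat.add_sub_cancel' hri] at this
  exact this

lemma tailSup_le (S : ℕ → V → ℝ) {m r : ℕ} (hrm : r ≤ m) {b : ℝ} {x : V}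
    (h : ∀ i, r ≤ i → i ≤ m → S i x ≤ b) : tailSup S m r x ≤ b := by
  rw [tailSup, Pi.partialSups_apply]
  exact partialSups_le _ _ _ fun j hj => h _ (by omega) (by omega)

lemma tailSup_anti (S : ℕ → V → ℝ) {m r r' : ℕ} (h : r ≤ r') (hm : r' ≤ m) :
    tailSup S m r' ≤ tailSup S m r := fun _ =>
  tailSup_le S hm fun _ h1 h2 => le_tailSup S (h.trans h1) h2 _

/-- The maximum of `s • S a + t • max (S a, …, S m)` over `a ≤ r`. For `r = m` it is
`(s + t) • max (S 0, …, S m)`. If the `S i` are the vertices of a simplex, regarded as linear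
functionals, the case `r < m` is the support function of the part of the dilated simplex that is cut
off by a hyperplane. -/
def sweep (S : ℕ → V → ℝ) (m : ℕ) (s t : ℝ≥0) (r : ℕ) : V → ℝ :=
  partialSups (fun a => s • S a + t • tailSup S m a) r

lemma sweep_last (S : ℕ → V → ℝ) (m : ℕ) (s t : ℝ≥0) :
    sweep S m s t m = (s + t) • partialSups S m := by
  ext x
  apply le_antisymm
  · rw [sweep, Pi.partialSups_apply]
    refine partialSups_le _ _ _ fun a ha => ?_
    have h1 : S a x ≤ partialSups S m x := le_partialSups_of_le S ha x
    have h2 : tailSup S m a x ≤ partialSups S m x :=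
      tailSup_le S ha fun i _ hi => le_partialSups_of_le S hi x
    simp only [Pi.add_apply, Pi.smul_apply, NNReal.smul_def, smul_eq_mul, NNReal.coe_add]
    rw [add_mul]
    gcongr
  · obtain ⟨a, ha, hax⟩ := exists_partialSups_apply_eq S m x
    have h := le_partialSups_of_le (fun a => s • S a + t • tailSup S m a) ha x
    have h2 := le_tailSup S (m := m) le_rfl ha x
    refine le_trans ?_ h
    simp only [Pi.add_apply, Pi.smul_apply, NNReal.smul_def, smul_eq_mul, NNReal.coe_add]
    rw [hax, add_mul]
    gcongr

lemma le_sweep (S : ℕ → V → ℝ) {m r : ℕ} (hr : r < m) (s t : ℝ≥0) :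
    s • partialSups S r + t • tailSup S m (r + 1) ≤ sweep S m s t r := by
  intro x
  obtain ⟨a, ha, hax⟩ := exists_partialSups_apply_eq S r x
  have h := le_partialSups_of_le (fun a => s • S a + t • tailSup S m a) ha x
  have h2 := tailSup_anti S (m := m) (r := a) (r' := r + 1) (by omega) (by omega) x
  refine le_trans ?_ h
  simp only [Pi.add_apply, Pi.smul_apply, NNReal.smul_def, smul_eq_mul]
  rw [hax]
  gcongr

lemma sweep_sup (S : ℕ → V → ℝ) {m r : ℕ} (hr : r < m) (s t : ℝ≥0) :
    sweep S m s t r ⊔ (s • partialSups S (r + 1) + t • tailSup S m (r + 1)) =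
      sweep S m s t (r + 1) := by
  have e : s • partialSups S (r + 1) + t • tailSup S m (r + 1) =
      (s • partialSups S r + t • tailSup S m (r + 1)) ⊔
        (s • S (r + 1) + t • tailSup S m (r + 1)) := by
    ext x
    simp [partialSups_add_one, NNReal.smul_def, mul_max_of_nonneg, max_add_add_right]
  rw [e, ← sup_assoc, sup_eq_left.2 (le_sweep S hr s t)]
  exact (partialSups_add_one _ _).symm

lemma sweep_inf (S : ℕ → V → ℝ) {m r : ℕ} (hr : r < m) (s t : ℝ≥0) :
    sweep S m s t r ⊓ (s • partialSups S (r + 1) + t • tailSup S m (r + 1)) =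
      s • partialSups S r + t • tailSup S m (r + 1) := by
  ext x
  simp only [Pi.inf_apply]
  apply le_antisymm
  · by_cases h : S (r + 1) x ≤ partialSups S r x
    · refine inf_le_right.trans (le_of_eq ?_)
      simp only [Pi.add_apply, Pi.smul_apply, partialSups_add_one, Pi.sup_apply, sup_eq_left.2 h]
    · refine inf_le_left.trans ?_
      push Not at h
      rw [sweep, Pi.partialSups_apply]
      refine partialSups_le _ _ _ fun a ha => ?_
      have h1 : S a x ≤ partialSups S r x := le_partialSups_of_le S ha x
      -- `S (r + 1)` dominates `S a, …, S r` at `x`, so these do not contribute to the tail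
      have h2 : tailSup S m a x ≤ tailSup S m (r + 1) x := by
        refine tailSup_le S (by omega) fun i _ hi => ?_
        by_cases hir : i ≤ r
        · have h3 : S i x ≤ partialSups S r x := le_partialSups_of_le S hir x
          exact (h3.trans h.le).trans (le_tailSup S le_rfl (by omega) x)
        · exact le_tailSup S (by omega) hi x
      simp only [Pi.add_apply, Pi.smul_apply, NNReal.smul_def, smul_eq_mul]
      gcongr
  · refine le_inf ?_ ?_
    · exact le_sweep S hr s t x
    · have h1 : partialSups S r x ≤ partialSups S (r + 1) x :=
        (partialSups S).monotone (Nat.le_succ r) x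
      simp only [Pi.add_apply, Pi.smul_apply, NNReal.smul_def, smul_eq_mul]
      gcongr

end Dissection

section Polynomiality

variable {V : Type*} [NormedAddCommGroup V] [NormedSpace ℝ V] {F : Type*} [AddCommGroup F]

/-- Along the ray spanned by a maximum of `m + 1` affine functions, an affinely invariant valuation
is a polynomial of degree at most `m`. -/
theorem isPolyLT_partialSups (m : ℕ) : ∀ {Z : (V → ℝ) → F}, IsAffineInvVal Z →
    ∀ {S : ℕ → V → ℝ}, (∀ i, S i ∈ affineFun V) →
      IsPolyLT (m + 1) (fun t => Z (t • partialSups S m)) := by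
  induction m using Nat.strong_induction_on with
  | _ m ih =>
  intro Z hZ S hS t
  have hS' : ∀ i, IsFinConv (S i) := fun i => isFinConv_of_mem_affineFun (hS i)
  have hu : ∀ r, IsFinConv (partialSups S r) := isFinConv_partialSups hS'
  have hw : ∀ r, IsFinConv (tailSup S m r) := fun r => isFinConv_partialSups (fun i => hS' _) _
  have hA : ∀ s r, IsFinConv (sweep S m s t r) := fun s r =>
    isFinConv_partialSups (fun a => ((hS' a).smul s).add ((hw a).smul t)) r
  have hmix : ∀ p q, p < m → IsPolyLT m
      (fun s : ℝ≥0 => Z (s • partialSups S p + t • tailSup S m q)) := fun p q hp =>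
    (ih p hp (hZ.comp_add ((hw q).smul t)) hS).mono hp
  have step : ∀ s : ℝ≥0, ∀ r < m, Z (sweep S m s t (r + 1)) = Z (sweep S m s t r)
      + Z (s • partialSups S (r + 1) + t • tailSup S m (r + 1))
      - Z (s • partialSups S r + t • tailSup S m (r + 1)) := by
    intro s r hr
    have h := hZ.val (sweep S m s t r)
      (s • partialSups S (r + 1) + t • tailSup S m (r + 1)) (hA s r)
      (((hu _).smul s).add ((hw _).smul t))
      (by rw [sweep_inf S hr]; exact ((hu _).smul s).add ((hw _).smul t))
    rw [sweep_inf S hr, sweep_sup S hr] at h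
    rw [h]
    abel
  have start : ∀ s : ℝ≥0, Z (sweep S m s t 0) = Z (t • tailSup S m 0) := by
    intro s
    rw [sweep, partialSups_zero, add_comm]
    exact hZ.inv _ ((hw 0).smul t) _ (nnreal_smul_mem_affineFun (hS 0) s)
  rcases Nat.eq_zero_or_pos m with rfl | hm
  · change fwdDiff t _ = 0
    ext s
    have h : ∀ s : ℝ≥0, Z (s • S 0) = Z 0 := fun s => by
      have := hZ.inv 0 (isFinConv_of_mem_affineFun (affineFun V).zero_mem) _
        (nnreal_smul_mem_affineFun (hS 0) s)
      rwa [zero_add] at this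
    simp [fwdDiff, h]
  · have part : ∀ r < m, IsPolyLT m (fun s => Z (sweep S m s t r)) := by
      intro r
      induction r with
      | zero =>
        intro _
        simp only [start]
        exact isPolyLT_const _ hm
      | succ r ihr =>
        intro hr
        have e : (fun s => Z (sweep S m s t (r + 1))) = (fun s => Z (sweep S m s t r))
            + (fun s => Z (s • partialSups S (r + 1) + t • tailSup S m (r + 1)))
            - (fun s => Z (s • partialSups S r + t • tailSup S m (r + 1))) := by
          ext s
          exact step s r (by omega)
        rw [e]
        exact ((ihr (by omega)).add (hmix _ _ hr)).sub (hmix _ _ (by omega))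
    obtain ⟨k, rfl⟩ : ∃ k, m = k + 1 := ⟨m - 1, by omega⟩
    -- the top piece is `s • f` plus an affine function, and cancels against `Z (s • f)`
    have e : fwdDiff t (fun s => Z (s • partialSups S (k + 1))) =
        (fun s => Z (sweep S (k + 1) s t k))
          - (fun s => Z (s • partialSups S k + t • tailSup S (k + 1) (k + 1))) := by
      ext s
      have h := step s k (by omega)
      rw [sweep_last, tailSup_self, hZ.inv _ ((hu _).smul s) _
        (nnreal_smul_mem_affineFun (hS _) t)] at h
      simp only [fwdDiff, Pi.sub_apply, tailSup_self]
      rw [h]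
      abel
    rw [e]
    exact (part k (by omega)).sub (hmix _ _ (by omega))

end Polynomiality

/-! ### Reduction to maxima of few affine functions -/

section Reduction

variable {V : Type*} [NormedAddCommGroup V] [NormedSpace ℝ V]

/-- `f` is a maximum of `m + 1` affine functions. -/
def IsMaxAffine : ℕ → (V → ℝ) → Prop
  | 0, f => f ∈ affineFun V
  | m + 1, f => ∃ a ∈ affineFun V, ∃ g, IsMaxAffine m g ∧ f = a ⊔ g

lemma IsMaxAffine.isFinConv : ∀ {m : ℕ} {f : V → ℝ}, IsMaxAffine m f → IsFinConv f
  | 0, _, h => isFinConv_of_mem_affineFun h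
  | _ + 1, _, ⟨_, ha, _, hg, h⟩ => h ▸ (isFinConv_of_mem_affineFun ha).sup hg.isFinConv

lemma IsMaxAffine.exists_partialSups : ∀ {m : ℕ} {f : V → ℝ}, IsMaxAffine m f →
    ∃ S : ℕ → V → ℝ, (∀ i, S i ∈ affineFun V) ∧ f = partialSups S m
  | 0, f, h => ⟨fun _ => f, fun _ => h, by simp⟩
  | m + 1, f, ⟨a, ha, g, hg, h⟩ => by
    obtain ⟨S, hS, rfl⟩ := hg.exists_partialSups
    refine ⟨fun i => if i ≤ m then S i else a, fun i => ?_, ?_⟩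
    · dsimp only
      split_ifs
      exacts [hS i, ha]
    · rw [h, partialSups_add_one, sup_comm]
      congr 1
      · refine eq_of_forall_ge_iff fun b => ?_
        simp only [partialSups_le_iff]
        exact forall₂_congr fun j hj => by rw [if_pos hj]
      · simp

lemma isMaxAffine_sup' {ι : Type*} {S : ι → V → ℝ} (hS : ∀ i, S i ∈ affineFun V)
    {J : Finset ι} (hJ : J.Nonempty) : IsMaxAffine (J.card - 1) (J.sup' hJ S) := by
  induction hJ using Finset.Nonempty.cons_induction with
  | singleton a => simpa [IsMaxAffine] using hS a
  | cons a s h hs ih =>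
    have : (Finset.cons a s h).card - 1 = (s.card - 1) + 1 := by
      rw [Finset.card_cons]
      have := hs.card_pos
      omega
    rw [this, Finset.sup'_cons hs]
    exact ⟨S a, hS a, _, ih, rfl⟩

lemma IsMaxAffine.foldr_sup {m : ℕ} {g : V → ℝ} (hg : IsMaxAffine m g) :
    ∀ {L : List (V → ℝ)}, (∀ a ∈ L, a ∈ affineFun V) →
      IsMaxAffine (m + L.length) (L.foldr (· ⊔ ·) g)
  | [], _ => hg
  | a :: L, hL => ⟨a, hL a (by simp), _,
      hg.foldr_sup (L := L) fun b hb => hL b (List.mem_cons_of_mem _ hb), rfl⟩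

lemma foldr_sup_le_iff {α : Type*} [SemilatticeSup α] {L : List α} {g b : α} :
    L.foldr (· ⊔ ·) g ≤ b ↔ (∀ a ∈ L, a ≤ b) ∧ g ≤ b := by
  induction L with
  | nil => simp
  | cons a L ih => simp [ih, and_assoc]

lemma foldr_sup_sup {α : Type*} [SemilatticeSup α] (L : List α) (a g : α) :
    L.foldr (· ⊔ ·) (a ⊔ g) = a ⊔ L.foldr (· ⊔ ·) g := by
  refine eq_of_forall_ge_iff fun b => ?_
  simp only [foldr_sup_le_iff, sup_le_iff]
  tauto

/-- Let `a₁, …, aₖ` be affine functions, some positive combination of which is bounded by the same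
combination of copies of `g`. Then `a₁ ⊔ … ⊔ aₖ ⊔ g` is built, using valuation relations, from
maxima of `g` with `k - 1` affine functions. For `k = 1` the function `a₁` is redundant. For
`k ≥ 2` one inserts the weighted mean `w` of `a₁` and `a₂`: since `w` lies between them,
`(w ⊔ a₁ ⊔ r) ⊓ (w ⊔ a₂ ⊔ r) = w ⊔ r` for all `r`, and both functions on the left satisfy the
hypothesis with `k - 1` affine functions, one of `a₁`, `a₂` being absorbed into `g`. -/
lemma foldr_sup_induction {P : (V → ℝ) → Prop}
    (hP : ∀ f₁ f₂, IsFinConv f₁ → IsFinConv f₂ → IsFinConv (f₁ ⊓ f₂) → P f₁ → P f₂ →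
      P (f₁ ⊓ f₂) → P (f₁ ⊔ f₂)) (k : ℕ) :
    ∀ L : List (ℝ × (V → ℝ)), L.length = k + 1 → (∀ p ∈ L, 0 < p.1 ∧ p.2 ∈ affineFun V) →
    ∀ m g, IsMaxAffine m g →
      (L.map (fun p => p.1 • p.2)).sum ≤ (L.map Prod.fst).sum • g →
      (∀ L' : List (V → ℝ), L'.length = k → (∀ a ∈ L', a ∈ affineFun V) →
        P (L'.foldr (· ⊔ ·) g)) →
      P ((L.map Prod.snd).foldr (· ⊔ ·) g) := by
  induction k with
  | zero =>
    intro L hL hpos m g hg hle hbase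
    obtain ⟨⟨α, a⟩, rfl⟩ := List.length_eq_one_iff.1 hL
    have hα : 0 < α := (hpos _ (List.mem_singleton_self _)).1
    have hag : a ≤ g := fun x => by
      have := hle x
      simp only [List.map_cons, List.map_nil, List.sum_cons, List.sum_nil, add_zero,
        Pi.smul_apply, smul_eq_mul] at this
      exact le_of_mul_le_mul_left this hα
    have := hbase [] rfl (by simp)
    simpa [sup_eq_right.2 hag] using this
  | succ k ih =>
    intro L hL hpos m g hg hle hbase
    match L, hL with
    | (α, a) :: (β, b) :: L, hL =>
    have hα : 0 < α := (hpos (α, a) (by simp)).1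
    have hβ : 0 < β := (hpos (β, b) (by simp)).1
    have ha : a ∈ affineFun V := (hpos (α, a) (by simp)).2
    have hb : b ∈ affineFun V := (hpos (β, b) (by simp)).2
    have hL' : ∀ p ∈ L, 0 < p.1 ∧ p.2 ∈ affineFun V := fun p hp => hpos p (by simp [hp])
    have hlen : L.length = k := by simpa using hL
    have hαβ : 0 < α + β := add_pos hα hβ
    set w : V → ℝ := (α + β)⁻¹ • (α • a + β • b) with hw_def
    have hw : w ∈ affineFun V := (affineFun V).smul_mem _
      ((affineFun V).add_mem ((affineFun V).smul_mem _ ha) ((affineFun V).smul_mem _ hb))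
    have hwe : (α + β) • w = α • a + β • b := smul_inv_smul₀ hαβ.ne' _
    have hwx : ∀ x, (α + β) * w x = α * a x + β * b x := fun x => congrFun hwe x
    have hwle : w ≤ a ⊔ b := fun x => by
      refine le_of_mul_le_mul_left ?_ hαβ
      rw [hwx, add_mul]
      exact add_le_add (mul_le_mul_of_nonneg_left le_sup_left hα.le)
        (mul_le_mul_of_nonneg_left le_sup_right hβ.le)
    have hlew : a ⊓ b ≤ w := fun x => by
      refine le_of_mul_le_mul_left ?_ hαβ
      rw [hwx, add_mul]
      exact add_le_add (mul_le_mul_of_nonneg_left inf_le_left hα.le)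
        (mul_le_mul_of_nonneg_left inf_le_right hβ.le)
    set R := (L.map Prod.snd).foldr (· ⊔ ·) g with hR
    have hRm : IsMaxAffine (m + (L.map Prod.snd).length) R :=
      hg.foldr_sup fun c hc => by
        obtain ⟨p, hp, rfl⟩ := List.mem_map.1 hc
        exact (hL' p hp).2
    have hsum : ((((α + β, w) :: L).map (fun p => p.1 • p.2))).sum ≤
        (((α + β, w) :: L).map Prod.fst).sum • g := by
      simpa only [List.map_cons, List.sum_cons, hwe, add_assoc] using hle
    have hnn : 0 ≤ (((α + β, w) :: L).map Prod.fst).sum := by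
      refine List.sum_nonneg fun c hc => ?_
      simp only [List.map_cons, List.mem_cons, List.mem_map] at hc
      rcases hc with rfl | ⟨p, hp, rfl⟩
      exacts [hαβ.le, (hL' p hp).1.le]
    have piece : ∀ c ∈ affineFun V, P (w ⊔ (c ⊔ R)) := fun c hc => by
      have := ih ((α + β, w) :: L) (by simp [hlen])
        (fun p hp => by
          rcases List.mem_cons.1 hp with rfl | hp
          exacts [⟨hαβ, hw⟩, hL' p hp])
        (m + 1) (c ⊔ g) ⟨c, hc, g, hg, rfl⟩
        (hsum.trans fun x => mul_le_mul_of_nonneg_left le_sup_right hnn)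
        (fun L'' hlen'' hL'' => by
          rw [foldr_sup_sup]
          exact hbase (c :: L'') (by simp [hlen''])
            (fun d hd => by
              rcases List.mem_cons.1 hd with rfl | hd
              exacts [hc, hL'' d hd]))
      rwa [List.map_cons, List.foldr_cons, foldr_sup_sup] at this
    have hwR : P (w ⊔ R) := hbase (w :: L.map Prod.snd) (by simp [hlen]) fun c hc => by
      rcases List.mem_cons.1 hc with rfl | hc
      · exact hw
      · obtain ⟨p, hp, rfl⟩ := List.mem_map.1 hc
        exact (hL' p hp).2
    have hcw := isFinConv_of_mem_affineFun hw
    have hca := isFinConv_of_mem_affineFun ha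
    have hcb := isFinConv_of_mem_affineFun hb
    have e1 : (w ⊔ (a ⊔ R)) ⊓ (w ⊔ (b ⊔ R)) = w ⊔ R := by
      rw [← sup_inf_left, ← sup_inf_right, ← sup_assoc, sup_eq_left.2 hlew]
    have e2 : (w ⊔ (a ⊔ R)) ⊔ (w ⊔ (b ⊔ R)) = a ⊔ (b ⊔ R) := by
      rw [← sup_sup_distrib_left, ← sup_sup_distrib_right, ← sup_assoc w, sup_eq_right.2 hwle,
        sup_assoc]
    have := hP (w ⊔ (a ⊔ R)) (w ⊔ (b ⊔ R)) (hcw.sup (hca.sup hRm.isFinConv))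
      (hcw.sup (hcb.sup hRm.isFinConv)) (by rw [e1]; exact hcw.sup hRm.isFinConv)
      (piece a ha) (piece b hb) (by rw [e1]; exact hwR)
    rwa [e2] at this

/-- The linear parts of `m + 1 > dim V + 1` affine functions are affinely dependent. -/
lemma exists_affine_relation [FiniteDimensional ℝ V] {m : ℕ} (hm : Module.finrank ℝ V < m)
    {S : Fin (m + 1) → V → ℝ} (hS : ∀ i, S i ∈ affineFun V) :
    ∃ c : Fin (m + 1) → ℝ, ∑ i, c i = 0 ∧ (∃ i, c i ≠ 0) ∧
      ∃ κ : ℝ, κ ≤ 0 ∧ ∀ x, ∑ i, c i * S i x = κ := by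
  choose l d hld using hS
  have hdim : Module.finrank ℝ ((V →L[ℝ] ℝ) × ℝ) = Module.finrank ℝ V + 1 := by
    rw [Module.finrank_prod, Module.finrank_self,
      ← (LinearMap.toContinuousLinearMap (𝕜 := ℝ) (E := V) (F' := ℝ)).finrank_eq]
    congr 1
    exact Subspace.dual_finrank_eq
  have hdep : ¬ LinearIndependent ℝ (fun i => ((l i, 1) : (V →L[ℝ] ℝ) × ℝ)) := fun h => by
    have := h.fintype_card_le_finrank
    rw [hdim, Fintype.card_fin] at this
    omega
  obtain ⟨c, hc, hc0⟩ := Fintype.not_linearIndependent_iff.1 hdep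
  have h1 : ∑ i, c i • l i = 0 := by
    have := congrArg Prod.fst hc
    simpa [Prod.fst_sum] using this
  have h2 : ∑ i, c i = 0 := by
    have := congrArg Prod.snd hc
    simpa [Prod.snd_sum] using this
  have h3 : ∀ x, ∑ i, c i * S i x = ∑ i, c i * d i := fun x => by
    have : ∑ i, c i * l i x = 0 := by
      have := congrArg (fun f : V →L[ℝ] ℝ => f x) h1
      simpa using this
    simp only [hld, mul_add, Finset.sum_add_distrib, this, zero_add]
  rcases le_total (∑ i, c i * d i) 0 with h | h
  · exact ⟨c, h2, hc0, _, h, h3⟩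
  · refine ⟨-c, by simp [h2], by simpa using hc0, -∑ i, c i * d i, by linarith, fun x => ?_⟩
    simp [h3]

/-- A property of maxima of affine functions that is compatible with valuation relations holds
in general if it holds for maxima of at most `dim V + 1` affine functions. -/
lemma IsMaxAffine.induction [FiniteDimensional ℝ V] {P : (V → ℝ) → Prop}
    (hP : ∀ f₁ f₂, IsFinConv f₁ → IsFinConv f₂ → IsFinConv (f₁ ⊓ f₂) → P f₁ → P f₂ →
      P (f₁ ⊓ f₂) → P (f₁ ⊔ f₂))
    (hbase : ∀ m ≤ Module.finrank ℝ V, ∀ f, IsMaxAffine m f → P f) (m : ℕ) :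
    ∀ f, IsMaxAffine m f → P f := by
  induction m using Nat.strong_induction_on with
  | _ m ih =>
  intro f hf
  by_cases hm : m ≤ Module.finrank ℝ V
  · exact hbase m hm f hf
  push Not at hm
  obtain ⟨S', hS', rfl⟩ := hf.exists_partialSups
  let S : Fin (m + 1) → V → ℝ := fun i => S' i
  have hS : ∀ i, S i ∈ affineFun V := fun i => hS' i
  obtain ⟨c, hc, ⟨i₀, hi₀⟩, κ, hκ, hrel⟩ := exists_affine_relation hm hS
  let I : Finset (Fin (m + 1)) := Finset.univ.filter fun i => 0 < c i
  let J : Finset (Fin (m + 1)) := Finset.univ.filter fun i => ¬ 0 < c i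
  have hcard : I.card + J.card = m + 1 := by
    rw [Finset.card_filter_add_card_filter_not]
    simp
  have hI : I.Nonempty := by
    by_contra h
    have hle : ∀ i, c i ≤ 0 := fun i => by
      by_contra hi
      exact h ⟨i, by simpa [I] using hi⟩
    exact hi₀ ((Finset.sum_eq_zero_iff_of_nonpos fun i _ => hle i).1 hc i₀ (Finset.mem_univ _))
  have hJ : J.Nonempty := by
    by_contra h
    have hlt : ∀ i, 0 < c i := fun i => by
      by_contra hi
      exact h ⟨i, by simpa [J] using hi⟩
    have : 0 < ∑ i, c i := Finset.sum_pos (fun i _ => hlt i) ⟨i₀, Finset.mem_univ _⟩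
    exact this.ne' hc
  have hI' := hI.card_pos
  have hJ' := hJ.card_pos
  have hg := isMaxAffine_sup' hS hJ
  have hf : partialSups S' m = ((I.toList.map fun i => (c i, S i)).map Prod.snd).foldr (· ⊔ ·)
      (J.sup' hJ S) := by
    refine eq_of_forall_ge_iff fun b => ?_
    rw [foldr_sup_le_iff, partialSups_le_iff]
    simp only [List.map_map, List.mem_map, Finset.mem_toList, Function.comp_apply,
      forall_exists_index, and_imp, forall_apply_eq_imp_iff₂, Finset.sup'_le_iff]
    constructor
    · intro h
      exact ⟨fun i _ => h i (Nat.lt_succ_iff.1 i.2), fun i _ => h i (Nat.lt_succ_iff.1 i.2)⟩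
    · rintro ⟨h1, h2⟩ i hi
      by_cases hci : 0 < c ⟨i, Nat.lt_succ_iff.2 hi⟩
      · exact h1 ⟨i, Nat.lt_succ_iff.2 hi⟩ (by simpa [I] using hci)
      · exact h2 ⟨i, Nat.lt_succ_iff.2 hi⟩ (by simpa [J] using hci)
  rw [hf]
  refine foldr_sup_induction hP (I.card - 1) _ ?_ ?_ _ _ hg ?_ ?_
  · simp only [List.length_map, Finset.length_toList]
    omega
  · intro p hp
    simp only [List.mem_map, Finset.mem_toList] at hp
    obtain ⟨i, hi, rfl⟩ := hp
    exact ⟨by simpa [I] using hi, hS i⟩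
  · simp only [List.map_map, Function.comp_def, Finset.sum_map_toList]
    intro x
    have hsplit : ∀ φ : Fin (m + 1) → ℝ, ∑ i, φ i = ∑ i ∈ I, φ i + ∑ i ∈ J, φ i := fun φ =>
      (Finset.sum_filter_add_sum_filter_not _ _ _).symm
    have h1 := hrel x
    rw [hsplit] at h1 hc
    have h2 : ∑ i ∈ J, c i * J.sup' hJ S x ≤ ∑ i ∈ J, c i * S i x := by
      refine Finset.sum_le_sum fun i hi => ?_
      have hci : c i ≤ 0 := by simpa [J] using hi
      exact mul_le_mul_of_nonpos_left (Finset.le_sup' S hi x) hci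
    rw [← Finset.sum_mul] at h2
    simp only [Finset.sum_apply, Pi.smul_apply, smul_eq_mul]
    have h3 : ∑ i ∈ I, c i = -∑ i ∈ J, c i := by linarith
    rw [h3]
    linarith
  · intro L' hlen hL'
    refine ih _ ?_ _ (hg.foldr_sup hL')
    omega

/-- Along the ray spanned by a maximum of arbitrarily many affine functions, an affinely invariant
valuation is a polynomial of degree at most `dim V`. -/
theorem IsMaxAffine.isPolyLT [FiniteDimensional ℝ V] {F : Type*} [AddCommGroup F]
    {Z : (V → ℝ) → F} (hZ : IsAffineInvVal Z) {m : ℕ} {f : V → ℝ} (hf : IsMaxAffine m f) :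
    IsPolyLT (Module.finrank ℝ V + 1) (fun t => Z (t • f)) := by
  refine IsMaxAffine.induction
    (P := fun f => IsPolyLT (Module.finrank ℝ V + 1) (fun t => Z (t • f))) ?_ ?_ m f hf
  · intro f₁ f₂ h₁ h₂ h₁₂ p₁ p₂ p₁₂
    have e : (fun t : ℝ≥0 => Z (t • (f₁ ⊔ f₂))) = (fun t => Z (t • f₁)) + (fun t => Z (t • f₂))
        - (fun t => Z (t • (f₁ ⊓ f₂))) := by
      ext t
      exact eq_sub_of_add_eq ((hZ.comp_smul t).val f₁ f₂ h₁ h₂ h₁₂).symm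
    rw [e]
    exact (p₁.add p₂).sub p₁₂
  · intro m hm f hf
    obtain ⟨S, hS, rfl⟩ := hf.exists_partialSups
    exact (isPolyLT_partialSups m hZ hS).mono (by omega)

end Reduction

/-! ### From vanishing differences to polynomials -/

section Polynomials

/-- The inverse of the Vandermonde matrix with nodes `1, …, n + 1`. -/
noncomputable def vandermondeInv (n : ℕ) : Matrix (Fin (n + 1)) (Fin (n + 1)) ℝ :=
  (Matrix.vandermonde fun j : Fin (n + 1) => ((j : ℕ) : ℝ) + 1)⁻¹

lemma vandermondeInv_mul (n : ℕ) (k i : Fin (n + 1)) :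
    ∑ j, vandermondeInv n k j * (((j : ℕ) : ℝ) + 1) ^ (i : ℕ) = if k = i then 1 else 0 := by
  have hdet : (Matrix.vandermonde fun j : Fin (n + 1) => ((j : ℕ) : ℝ) + 1).det ≠ 0 := by
    rw [Matrix.det_vandermonde_ne_zero_iff]
    intro a b hab
    simpa [Fin.ext_iff] using hab
  have h := Matrix.nonsing_inv_mul _ (isUnit_iff_ne_zero.2 hdet)
  have := congrFun (congrFun h k) i
  simpa [Matrix.mul_apply, Matrix.one_apply, vandermondeInv] using this

variable {F : Type*} [AddCommGroup F] [Module ℝ F]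

/-- The coefficients of a polynomial of degree at most `n` are determined by its values at
`1, …, n + 1`. -/
lemma vandermondeInv_smul {n : ℕ} {c y : Fin (n + 1) → F}
    (h : ∀ j : Fin (n + 1), y j = ∑ i : Fin (n + 1), (((j : ℕ) : ℝ) + 1) ^ (i : ℕ) • c i)
    (k : Fin (n + 1)) : ∑ j, vandermondeInv n k j • y j = c k := by
  simp only [h, Finset.smul_sum, smul_smul]
  rw [Finset.sum_comm]
  simp only [← Finset.sum_smul, vandermondeInv_mul, ite_smul, one_smul, zero_smul,
    Finset.sum_ite_eq, Finset.mem_univ, if_true]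

/-- On the multiples of a fixed step, `φ` is a polynomial, by Newton's forward difference
formula. -/
lemma IsPolyLT.exists_coeff {n : ℕ} {φ : ℝ≥0 → F} (hφ : IsPolyLT (n + 1) φ) (h : ℝ≥0) :
    ∃ d : ℕ → F, ∀ N : ℕ, φ (N • h) = ∑ i ∈ Finset.range (n + 1), (N : ℝ) ^ i • d i := by
  let p : ℕ → Polynomial ℝ := fun k =>
    Polynomial.C ((k.factorial : ℝ)⁻¹) * descPochhammer ℝ k
  have hp : ∀ k N : ℕ, (N.choose k : ℝ) = (p k).eval (N : ℝ) := fun k N => by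
    rw [Nat.cast_choose_eq_descPochhammer_div]
    simp [p, div_eq_inv_mul]
  have hdeg : ∀ k ∈ Finset.range (n + 1), (p k).natDegree < n + 1 := fun k hk =>
    lt_of_le_of_lt ((Polynomial.natDegree_C_mul_le _ _).trans_eq
      (descPochhammer_natDegree ℝ k)) (Finset.mem_range.1 hk)
  refine ⟨fun i => ∑ k ∈ Finset.range (n + 1), (p k).coeff i • (fwdDiff h)^[k] φ 0,
    fun N => ?_⟩
  have h1 : φ (N • h) =
      ∑ k ∈ Finset.range (n + 1), (N.choose k : ℝ) • (fwdDiff h)^[k] φ 0 := by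
    have e := shift_eq_sum_fwdDiff_iter h φ N 0
    rw [zero_add] at e
    rw [e]
    simp only [Nat.cast_smul_eq_nsmul]
    have hz : ∀ k, n + 1 ≤ k → N.choose k • (fwdDiff h)^[k] φ 0 = 0 := fun k hk => by
      rw [hφ.iterate_fwdDiff h k hk]
      simp
    have hz' : ∀ k, N + 1 ≤ k → N.choose k • (fwdDiff h)^[k] φ 0 = 0 := fun k hk => by
      rw [Nat.choose_eq_zero_of_lt hk, zero_smul]
    exact (Finset.sum_subset (Finset.range_mono (le_max_left (N + 1) (n + 1)))
        fun k _ hk => hz' k (by simpa using hk)).trans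
      (Finset.sum_subset (Finset.range_mono (le_max_right (N + 1) (n + 1)))
        fun k _ hk => hz k (by simpa using hk)).symm
  rw [h1]
  simp only [Finset.smul_sum, smul_smul]
  rw [Finset.sum_comm]
  refine Finset.sum_congr rfl fun k hk => ?_
  rw [hp, Polynomial.eval_eq_sum_range' (hdeg k hk), Finset.sum_smul]
  exact Finset.sum_congr rfl fun i _ => by rw [mul_comm]

/-- A continuous function with vanishing differences of order `n + 1` is a polynomial of degree
at most `n`, written here in terms of its values at `1, …, n + 1`. -/
lemma IsPolyLT.eq_sum [TopologicalSpace F] [IsTopologicalAddGroup F] [ContinuousSMul ℝ F]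
    [T2Space F] {n : ℕ} {φ : ℝ≥0 → F} (hφ : IsPolyLT (n + 1) φ) (hc : Continuous φ) (t : ℝ≥0) :
    φ t = ∑ k : Fin (n + 1), (t : ℝ) ^ (k : ℕ) •
      ∑ j : Fin (n + 1), vandermondeInv n k j • φ (((j : ℕ) : ℝ≥0) + 1) := by
  have key : (fun t : ℝ => φ t.toNNReal) = fun t : ℝ => ∑ k : Fin (n + 1),
      (t.toNNReal : ℝ) ^ (k : ℕ) •
        ∑ j : Fin (n + 1), vandermondeInv n k j • φ (((j : ℕ) : ℝ≥0) + 1) := by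
    refine (Rat.denseRange_cast (𝕜 := ℝ)).equalizer (by fun_prop) (by fun_prop) ?_
    ext r
    simp only [Function.comp_apply]
    have hq : (0 : ℝ) < r.den := by exact_mod_cast r.den_pos
    set h : ℝ≥0 := (r.den : ℝ≥0)⁻¹ with hh
    have hq' : (r.den : ℝ≥0) ≠ 0 := by exact_mod_cast r.den_ne_zero
    have hr : (r : ℝ).toNNReal = r.num.toNat • h := by
      rw [nsmul_eq_mul, hh, ← div_eq_mul_inv]
      conv_lhs => rw [Rat.cast_def, Real.toNNReal_div' hq.le, Real.toNNReal_natCast]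
      congr 1
      rcases le_total 0 r.num with h0 | h0
      · have : (r.num : ℝ) = (r.num.toNat : ℝ) := by exact_mod_cast (Int.toNat_of_nonneg h0).symm
        rw [this, Real.toNNReal_natCast]
      · rw [Int.toNat_of_nonpos h0, Real.toNNReal_of_nonpos (by exact_mod_cast h0)]
        simp
    obtain ⟨d, hd⟩ := hφ.exists_coeff h
    have hd' : ∀ N : ℕ, φ (N • h) = ∑ i : Fin (n + 1), ((N • h : ℝ≥0) : ℝ) ^ (i : ℕ) •
        ((r.den : ℝ) ^ (i : ℕ) • d i) := fun N => by
      rw [hd, ← Fin.sum_univ_eq_sum_range (fun i => (N : ℝ) ^ i • d i)]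
      refine Finset.sum_congr rfl fun i _ => ?_
      rw [smul_smul, ← mul_pow]
      congr 2
      simp [hh, hq.ne']
    have hnode : ∀ j : Fin (n + 1), (((j : ℕ) : ℝ≥0) + 1) = ((j + 1) * r.den : ℕ) • h :=
      fun j => by
        rw [nsmul_eq_mul, hh]
        push_cast
        rw [mul_assoc, mul_inv_cancel₀ hq', mul_one]
    have hcoef := vandermondeInv_smul (n := n) (c := fun i => (r.den : ℝ) ^ (i : ℕ) • d i)
      (y := fun j => φ (((j : ℕ) : ℝ≥0) + 1)) fun j => by
        rw [hnode j, hd', ← hnode j]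
        simp
    simp only [hcoef]
    rw [hr]
    exact hd' _
  simpa using congrFun key (t : ℝ)

end Polynomials

/-! ### Approximation from below by maxima of affine functions -/

section Approximation

variable {V : Type*} [NormedAddCommGroup V] [NormedSpace ℝ V]

lemma Conv.exists_real_eq {f : V → EReal} (hf : f ∈ Conv V) {x : V} (hx : f x ≠ ⊤) :
    ∃ s : ℝ, f x = s :=
  ⟨(f x).toReal, (EReal.coe_toReal hx (hf.1 x)).symm⟩

/-- Separation of a point from the epigraph of `f`. -/
lemma Conv.exists_separation {f : V → EReal} (hf : f ∈ Conv V) {x₀ : V} {r₀ : ℝ}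
    (h : (r₀ : EReal) < f x₀) : ∃ (l : V →L[ℝ] ℝ) (b u : ℝ), 0 ≤ b ∧ l x₀ + b * r₀ < u ∧
      ∀ (x : V) (s : ℝ), f x = s → u < l x + b * s := by
  let E : Set (V × ℝ) := {p | f p.1 ≤ (p.2 : EReal)}
  have hclosed : IsClosed E :=
    hf.2.2.1.isClosed_epigraph.preimage (f := fun p : V × ℝ => (p.1, (p.2 : EReal)))
      (continuous_fst.prodMk (continuous_coe_real_ereal.comp continuous_snd))
  have hconv : Convex ℝ E := by
    rintro ⟨x, r⟩ hx ⟨y, s⟩ hy a b ha hb hab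
    simp only [E, Set.mem_ofPred_eq] at hx hy
    obtain ⟨r', hr'⟩ := Conv.exists_real_eq hf (ne_top_of_le_ne_top (EReal.coe_ne_top r) hx)
    obtain ⟨s', hs'⟩ := Conv.exists_real_eq hf (ne_top_of_le_ne_top (EReal.coe_ne_top s) hy)
    have h1 := hf.2.1 x y a ⟨ha, by linarith⟩
    have hb' : 1 - a = b := by linarith
    rw [hb', hr', hs'] at h1
    rw [hr', EReal.coe_le_coe_iff] at hx
    rw [hs', EReal.coe_le_coe_iff] at hy
    refine h1.trans ?_
    rw [← EReal.coe_mul, ← EReal.coe_mul, ← EReal.coe_add, EReal.coe_le_coe_iff]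
    simp only [Prod.smul_mk, Prod.mk_add_mk, smul_eq_mul]
    gcongr
  obtain ⟨φ, u, hu1, hu2⟩ := geometric_hahn_banach_point_closed hconv hclosed
    (x := (x₀, r₀)) (by simpa [E] using h)
  have hφ : ∀ x s, φ (x, s) = φ (x, 0) + φ (0, 1) * s := fun x s => by
    have : ((x, s) : V × ℝ) = (x, 0) + s • (0, 1) := by simp
    rw [this, map_add, map_smul, smul_eq_mul, mul_comm s]
  have hE : ∀ (x : V) (s : ℝ), f x ≤ (s : EReal) → u < φ (x, 0) + φ (0, 1) * s := fun x s hs => by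
    rw [← hφ]
    exact hu2 (x, s) hs
  refine ⟨φ.comp (ContinuousLinearMap.inl ℝ V ℝ), φ (0, 1), u, ?_, ?_, fun x s hs => ?_⟩
  · by_contra! hneg
    obtain ⟨x₁, hx₁⟩ := hf.2.2.2
    obtain ⟨s₁, hs₁⟩ := Conv.exists_real_eq hf hx₁
    have h1 := hE x₁ (max s₁ ((u - φ (x₁, 0)) / φ (0, 1)))
      (by rw [hs₁, EReal.coe_le_coe_iff]; exact le_max_left _ _)
    have h2 := mul_le_mul_of_nonpos_left (le_max_right s₁ ((u - φ (x₁, 0)) / φ (0, 1))) hneg.le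
    rw [mul_div_cancel₀ _ hneg.ne] at h2
    linarith
  · simpa [← hφ] using hu1
  · simpa using hE x s hs.le

/-- A non-vertical separating hyperplane is the graph of an affine minorant. -/
lemma Conv.exists_minorant_of_pos {f : V → EReal} (hf : f ∈ Conv V) {x₀ : V} {r₀ : ℝ}
    {l : V →L[ℝ] ℝ} {b u : ℝ} (hb : 0 < b) (h₀ : l x₀ + b * r₀ < u)
    (h : ∀ (x : V) (s : ℝ), f x = s → u < l x + b * s) :
    ∃ (l : V →L[ℝ] ℝ) (c : ℝ), (∀ x, ((l x + c : ℝ) : EReal) ≤ f x) ∧ r₀ < l x₀ + c := by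
  have e : ∀ x, (-(b⁻¹ • l)) x + u / b = (u - l x) / b := fun x => by
    simp; field_simp; ring
  refine ⟨-(b⁻¹ • l), u / b, fun x => ?_, ?_⟩
  · by_cases hx : f x = ⊤
    · rw [hx]
      exact le_top
    · obtain ⟨s, hs⟩ := Conv.exists_real_eq hf hx
      have := h x s hs
      rw [hs, EReal.coe_le_coe_iff, e, div_le_iff₀ hb]
      linarith
  · rw [e, lt_div_iff₀ hb]
    linarith

lemma Conv.exists_minorant {f : V → EReal} (hf : f ∈ Conv V) {x₀ : V} {r₀ : ℝ}
    (h : (r₀ : EReal) < f x₀) :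
    ∃ (l : V →L[ℝ] ℝ) (c : ℝ), (∀ x, ((l x + c : ℝ) : EReal) ≤ f x) ∧ r₀ < l x₀ + c := by
  obtain ⟨l, b, u, hb, h₀, hlt⟩ := Conv.exists_separation hf h
  rcases hb.lt_or_eq with hb | rfl
  · exact Conv.exists_minorant_of_pos hf hb h₀ hlt
  -- The separating hyperplane is vertical: a large multiple of `u - l`, which is negative on the
  -- domain of `f` and positive at `x₀`, is added to an arbitrary affine minorant.
  obtain ⟨x₁, hx₁⟩ := hf.2.2.2
  obtain ⟨s₁, hs₁⟩ := Conv.exists_real_eq hf hx₁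
  obtain ⟨l₁, b₁, u₁, hb₁, h₁, hlt₁⟩ := Conv.exists_separation hf (x₀ := x₁) (r₀ := s₁ - 1)
    (by rw [hs₁, EReal.coe_lt_coe_iff]; linarith)
  have hb₁' : 0 < b₁ := by
    have := hlt₁ x₁ s₁ hs₁
    nlinarith
  obtain ⟨l₂, c₂, hle, -⟩ := Conv.exists_minorant_of_pos hf hb₁' h₁ hlt₁
  simp only [zero_mul, add_zero] at h₀ hlt
  obtain ⟨N, hN⟩ := exists_nat_gt ((r₀ - (l₂ x₀ + c₂)) / (u - l x₀))
  rw [div_lt_iff₀ (by linarith)] at hN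
  refine ⟨l₂ - (N : ℝ) • l, c₂ + N * u, fun x => ?_, ?_⟩
  · by_cases hx : f x = ⊤
    · rw [hx]
      exact le_top
    · obtain ⟨s, hs⟩ := Conv.exists_real_eq hf hx
      refine le_trans ?_ (hle x)
      rw [EReal.coe_le_coe_iff]
      have := mul_le_mul_of_nonneg_left (hlt x s hs).le (Nat.cast_nonneg (α := ℝ) N)
      simp
      linarith
  · simp
    linarith

/-- Every element of `Conv V` is the limit of an increasing sequence of maxima of finitely many
affine functions. -/
lemma Conv.exists_approx [FiniteDimensional ℝ V] {f : V → EReal} (hf : f ∈ Conv V) :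
    ∃ g : ℕ → V → ℝ, (∀ j, IsMaxAffine j (g j)) ∧ Monotone g ∧
      ∀ x, Tendsto (fun j => (g j x : EReal)) atTop (𝓝 (f x)) := by
  let M : Set ((V →L[ℝ] ℝ) × ℝ) := {p | ∀ x, ((p.1 x + p.2 : ℝ) : EReal) ≤ f x}
  have hM : Nonempty M := by
    obtain ⟨r, -, hr⟩ := EReal.lt_iff_exists_real_btwn.1 (bot_lt_iff_ne_bot.2 (hf.1 0))
    obtain ⟨l, c, h, -⟩ := Conv.exists_minorant hf hr
    exact ⟨⟨(l, c), h⟩⟩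
  let p : ℕ → M := TopologicalSpace.denseSeq M
  let S : ℕ → V → ℝ := fun i x => (p i).1.1 x + (p i).1.2
  have hS : ∀ i, S i ∈ affineFun V := fun i => ⟨_, _, rfl⟩
  refine ⟨partialSups S, fun j => ?_, (partialSups S).monotone, fun x => ?_⟩
  · rw [partialSups_eq_sup'_range]
    simpa using isMaxAffine_sup' hS (Finset.nonempty_range_add_one (n := j))
  · have hle : ∀ j, ((partialSups S j x : ℝ) : EReal) ≤ f x := fun j => by
      obtain ⟨a, -, ha⟩ := exists_partialSups_apply_eq S j x
      rw [ha]
      exact (p a).2 x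
    refine tendsto_order.2 ⟨fun a ha => ?_, fun a ha => .of_forall fun j => (hle j).trans_lt ha⟩
    obtain ⟨r, har, hr⟩ := EReal.lt_iff_exists_real_btwn.1 ha
    obtain ⟨l, c, h, hlc⟩ := Conv.exists_minorant hf hr
    have hopen : IsOpen {q : M | r < q.1.1 x + q.1.2} :=
      isOpen_lt continuous_const (by fun_prop)
    obtain ⟨_, hi, i, rfl⟩ := (TopologicalSpace.denseRange_denseSeq M).inter_open_nonempty _ hopen
      ⟨⟨(l, c), h⟩, hlc⟩
    filter_upwards [eventually_ge_atTop i] with j hj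
    refine har.trans (EReal.coe_lt_coe_iff.2 (lt_of_lt_of_le hi ?_))
    exact le_partialSups_of_le S hj x

lemma epiConverges_of_monotone {W : Type*} [TopologicalSpace W] {G : ℕ → W → EReal}
    {h : W → EReal} (hmono : Monotone G) (hlsc : ∀ j, LowerSemicontinuous (G j))
    (hlim : ∀ x, Tendsto (fun j => G j x) atTop (𝓝 (h x))) : EpiConverges G h := by
  refine fun x => ⟨fun u hu => le_of_forall_lt fun a ha => ?_, fun _ => x, tendsto_const_nhds,
    hlim x⟩
  obtain ⟨b, hab, hb⟩ := exists_between ha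
  obtain ⟨k, hk⟩ := ((hlim x).eventually_const_lt hb).exists
  refine hab.trans_le (le_liminf_of_le (by isBoundedDefault) ?_)
  filter_upwards [hu.eventually (hlsc k x b hk), eventually_ge_atTop k] with j hj hkj
  exact hj.le.trans (hmono hkj _)

end Approximation

/-! ### Cones of convex functions -/

section Cone

variable {V : Type*} [NormedAddCommGroup V] [NormedSpace ℝ V]

/-- A real-valued function, regarded as a function with values in `EReal`. -/
def ofReal {V : Type*} (f : V → ℝ) : V → EReal := fun x => f x

lemma IsFinConv.mem_convFinite {f : V → ℝ} (hf : IsFinConv f) : ofReal f ∈ ConvFinite V := by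
  refine ⟨⟨fun x => EReal.coe_ne_bot _, fun x y t ht => ?_,
    (continuous_coe_real_ereal.comp hf.2).lowerSemicontinuous, 0, EReal.coe_ne_top _⟩,
    fun x => EReal.coe_lt_top _⟩
  have := hf.1.2 (Set.mem_univ x) (Set.mem_univ y) ht.1 (sub_nonneg.2 ht.2) (by ring)
  simp only [ofReal]
  exact_mod_cast this

lemma scale_ofReal {V : Type*} (t : ℝ≥0) (f : V → ℝ) : scale (t : ℝ) (ofReal f) = ofReal (t • f) := by
  ext x
  simp [scale, ofReal, NNReal.smul_def]

lemma scale_scale {W : Type*} (s t : ℝ) (f : W → EReal) :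
    scale s (scale t f) = scale (s * t) f := by
  ext x
  simp [scale, mul_assoc]

lemma scale_one {W : Type*} (f : W → EReal) : scale 1 f = f := by
  ext x
  simp [scale]

lemma continuous_coe_mul {t : ℝ} (ht : 0 < t) : Continuous fun a : EReal => (t : EReal) * a := by
  have h0 : (t : EReal) ≠ 0 := by exact_mod_cast ht.ne'
  refine continuous_iff_continuousAt.2 fun a => ?_
  exact (EReal.continuousAt_mul (p := ((t : EReal), a)) (.inl h0) (.inl h0)
    (.inl (EReal.coe_ne_bot _)) (.inl (EReal.coe_ne_top _))).comp
    (f := fun a : EReal => ((t : EReal), a)) (by fun_prop)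

lemma monotone_coe_mul {t : ℝ} (ht : 0 < t) : Monotone fun a : EReal => (t : EReal) * a :=
  fun _ _ h => mul_le_mul_of_nonneg_left h (by exact_mod_cast ht.le)

lemma EpiConverges.scale {W : Type*} [TopologicalSpace W] {f : ℕ → W → EReal} {g : W → EReal}
    (h : EpiConverges f g) {t : ℝ} (ht : 0 < t) :
    EpiConverges (fun j => scale t (f j)) (scale t g) := by
  refine fun x => ⟨fun u hu => ?_, ?_⟩
  · have h1 := (monotone_coe_mul ht).map_liminf_of_continuousAt (F := atTop)
      (fun j => f j (u j)) (continuous_coe_mul ht).continuousAt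
    refine (monotone_coe_mul ht ((h x).1 u hu)).trans (h1.trans_le ?_)
    rfl
  · obtain ⟨u, hu, hlim⟩ := (h x).2
    exact ⟨u, hu, ((continuous_coe_mul ht).tendsto _).comp hlim⟩

variable {C : Set (V → EReal)}

lemma scale_mem (hC : C ⊆ Conv V) (hcone : IsCone C) (hfin : ConvFinite V ⊆ C)
    {f : V → EReal} (hf : f ∈ C) {t : ℝ} (ht : 0 < t) : scale t f ∈ C := by
  have h0 : ofReal (0 : V → ℝ) ∈ C :=
    hfin (isFinConv_of_mem_affineFun (affineFun V).zero_mem).mem_convFinite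
  obtain ⟨x, hx⟩ := (hC hf).2.2.2
  obtain ⟨s, hs⟩ := Conv.exists_real_eq (hC hf) hx
  have e : ofReal (0 : V → ℝ) + scale t f = scale t f := by
    ext y
    simp [ofReal]
  have := hcone _ h0 f hf t ht ⟨x, by
    rw [e, scale, hs, ← EReal.coe_mul]
    exact EReal.coe_ne_top _⟩
  rwa [e] at this

variable {F : Type*} [AddCommGroup F]

open Classical in
/-- The function on finite convex functions induced by `μ`, extended by zero. -/
noncomputable def onReal {V : Type*} {C : Set (V → EReal)} (μ : C → F) (f : V → ℝ) : F :=
  if h : ofReal f ∈ C then μ ⟨ofReal f, h⟩ else 0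

lemma onReal_of_mem {V : Type*} {C : Set (V → EReal)} (μ : C → F) {f : V → ℝ} (h : ofReal f ∈ C) :
    onReal μ f = μ ⟨ofReal f, h⟩ := dif_pos h

lemma isAffineInvVal_onReal (hfin : ConvFinite V ⊆ C) {μ : C → F} (hval : IsValuation μ)
    (hinv : IsDuallyEpiTranslationInvariant μ) : IsAffineInvVal (onReal μ) where
  val f g hf hg hfg := by
    have hf' := hfin hf.mem_convFinite
    have hg' := hfin hg.mem_convFinite
    have hs' := hfin (hf.sup hg).mem_convFinite
    have hi' := hfin hfg.mem_convFinite
    rw [onReal_of_mem μ hf', onReal_of_mem μ hg', onReal_of_mem μ hs', onReal_of_mem μ hi']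
    have es : ofReal f ⊔ ofReal g = ofReal (f ⊔ g) := by
      ext x
      exact (EReal.coe_strictMono.monotone.map_max).symm
    have ei : ofReal f ⊓ ofReal g = ofReal (f ⊓ g) := by
      ext x
      exact (EReal.coe_strictMono.monotone.map_min).symm
    have := hval ⟨_, hf'⟩ ⟨_, hg'⟩ (by rw [es]; exact hs') (by rw [ei]; exact hi')
    simpa only [es, ei] using this
  inv f hf a ha := by
    have hf' := hfin hf.mem_convFinite
    have hfa' := hfin (hf.add (isFinConv_of_mem_affineFun ha)).mem_convFinite
    rw [onReal_of_mem μ hf', onReal_of_mem μ hfa']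
    obtain ⟨l, c, rfl⟩ := ha
    exact hinv ⟨_, hf'⟩ l c hfa'

lemma continuous_onReal_smul [TopologicalSpace F] (hfin : ConvFinite V ⊆ C) {μ : C → F}
    (hμ : IsEpiContinuous μ) {f : V → ℝ} (hf : IsFinConv f) :
    Continuous fun t : ℝ≥0 => onReal μ (t • f) := by
  have hmem : ∀ t : ℝ≥0, ofReal (t • f) ∈ C := fun t => hfin (hf.smul t).mem_convFinite
  simp only [fun t : ℝ≥0 => onReal_of_mem μ (hmem t)]
  refine continuous_iff_seqContinuous.2 fun t t₀ ht => ?_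
  refine hμ (fun j => ⟨_, hmem (t j)⟩) ⟨_, hmem t₀⟩ fun x => ?_
  have key : ∀ u : ℕ → V, Tendsto u atTop (𝓝 x) →
      Tendsto (fun j => ofReal (t j • f) (u j)) atTop (𝓝 (ofReal (t₀ • f) x)) := fun u hu =>
    (continuous_coe_real_ereal.tendsto _).comp
      (((NNReal.continuous_coe.tendsto _).comp ht).mul ((hf.2.tendsto x).comp hu))
  exact ⟨fun u hu => (key u hu).liminf_eq.ge, fun _ => x, tendsto_const_nhds,
    key _ tendsto_const_nhds⟩

end Cone

/-! ### Homogeneous components -/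

section Components

variable {V : Type*} [NormedAddCommGroup V] [NormedSpace ℝ V]
  {F : Type*} [AddCommGroup F] [Module ℝ F] [TopologicalSpace F] [IsTopologicalAddGroup F]
  [ContinuousSMul ℝ F] {C : Set (V → EReal)}

/-- The valuation `f ↦ μ (t f)`. -/
noncomputable def dilate (hC : C ⊆ Conv V) (hcone : IsCone C) (hfin : ConvFinite V ⊆ C) (μ : VConv C F)
    {t : ℝ} (ht : 0 < t) : VConv C F := by
  refine ⟨fun f => μ.1 ⟨scale t f, scale_mem hC hcone hfin f.2 ht⟩,
    fun f h hmax hmin => ?_, fun f g hfg => ?_, fun f l c hf => ?_⟩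
  · have es : scale t (f : V → EReal) ⊔ scale t h = scale t ((f : V → EReal) ⊔ h) := by
      ext x
      exact ((monotone_coe_mul ht).map_max).symm
    have ei : scale t (f : V → EReal) ⊓ scale t h = scale t ((f : V → EReal) ⊓ h) := by
      ext x
      exact ((monotone_coe_mul ht).map_min).symm
    have := μ.2.1 ⟨_, scale_mem hC hcone hfin f.2 ht⟩ ⟨_, scale_mem hC hcone hfin h.2 ht⟩
      (by rw [es]; exact scale_mem hC hcone hfin hmax ht)
      (by rw [ei]; exact scale_mem hC hcone hfin hmin ht)
    simpa only [es, ei] using this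
  · exact μ.2.2.1 _ ⟨_, scale_mem hC hcone hfin g.2 ht⟩ (hfg.scale ht)
  · have e : (fun x => scale t (f : V → EReal) x + (((t • l) x + t * c : ℝ) : EReal)) =
        scale t (fun x => (f : V → EReal) x + ((l x + c : ℝ) : EReal)) := by
      ext x
      simp only [scale]
      rw [EReal.left_distrib_of_nonneg_of_ne_top (by exact_mod_cast ht.le) (EReal.coe_ne_top t),
        ← EReal.coe_mul]
      congr 2
      simp
      ring
    have := μ.2.2.2 ⟨_, scale_mem hC hcone hfin f.2 ht⟩ (t • l) (t * c)
      (by rw [e]; exact scale_mem hC hcone hfin hf ht)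
    simpa only [e] using this

/-- The homogeneous component of degree `k` of `μ`: the coefficient of `t ^ k` in the polynomial
`t ↦ μ (t f)` of degree at most `dim V`, computed from the values at `t = 1, …, dim V + 1`. -/
noncomputable def component (hC : C ⊆ Conv V) (hcone : IsCone C) (hfin : ConvFinite V ⊆ C)
    (μ : VConv C F) (k : Fin (Module.finrank ℝ V + 1)) : VConv C F :=
  ∑ j : Fin (Module.finrank ℝ V + 1), vandermondeInv (Module.finrank ℝ V) k j •
    dilate hC hcone hfin μ (t := ((j : ℕ) : ℝ) + 1) (by positivity)

lemma component_apply (hC : C ⊆ Conv V) (hcone : IsCone C) (hfin : ConvFinite V ⊆ C)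
    (μ : VConv C F) (k : Fin (Module.finrank ℝ V + 1)) (f : C) :
    (component hC hcone hfin μ k).1 f =
      ∑ j : Fin (Module.finrank ℝ V + 1), vandermondeInv (Module.finrank ℝ V) k j •
        μ.1 ⟨scale (((j : ℕ) : ℝ) + 1) f, scale_mem hC hcone hfin f.2 (by positivity)⟩ := by
  rw [component, Submodule.coe_sum, Finset.sum_apply]
  rfl

/-- For every `f ∈ C`, the function `t ↦ μ (t f)` is a polynomial of degree at most `dim V` on
`(0, ∞)`. -/
theorem apply_scale_eq_sum [FiniteDimensional ℝ V] [T2Space F] (hC : C ⊆ Conv V)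
    (hcone : IsCone C) (hfin : ConvFinite V ⊆ C) (μ : VConv C F) (f : C) {t : ℝ} (ht : 0 < t) :
    μ.1 ⟨scale t f, scale_mem hC hcone hfin f.2 ht⟩ =
      ∑ k : Fin (Module.finrank ℝ V + 1), t ^ (k : ℕ) • (component hC hcone hfin μ k).1 f := by
  obtain ⟨g, hg, hmono, hlim⟩ := Conv.exists_approx (hC f.2)
  have hg' : ∀ j, IsFinConv (g j) := fun j => (hg j).isFinConv
  have hmem : ∀ (s : ℝ≥0) (j : ℕ), ofReal (s • g j) ∈ C := fun s j =>
    hfin ((hg' j).smul s).mem_convFinite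
  have hepi : EpiConverges (fun j => ofReal (g j)) f := by
    refine epiConverges_of_monotone (fun i j hij x => ?_) (fun j => ?_) hlim
    · exact EReal.coe_le_coe_iff.2 (hmono hij x)
    · exact (hg' j).mem_convFinite.1.2.2.1
  have htend : ∀ (s : ℝ≥0) (hs : (0 : ℝ) < s), Tendsto (fun j => onReal μ.1 (s • g j)) atTop
      (𝓝 (μ.1 ⟨scale (s : ℝ) f, scale_mem hC hcone hfin f.2 hs⟩)) := fun s hs => by
    simp only [fun j => onReal_of_mem μ.1 (hmem s j)]
    refine μ.2.2.1 (fun j => ⟨_, hmem s j⟩) ⟨_, scale_mem hC hcone hfin f.2 hs⟩ ?_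
    simpa only [scale_ofReal] using hepi.scale hs
  lift t to ℝ≥0 using ht.le
  refine tendsto_nhds_unique (htend t ht) ?_
  have hpoly : ∀ j, onReal μ.1 (t • g j) = ∑ k : Fin (Module.finrank ℝ V + 1), (t : ℝ) ^ (k : ℕ) •
      ∑ i : Fin (Module.finrank ℝ V + 1), vandermondeInv (Module.finrank ℝ V) k i •
        onReal μ.1 ((((i : ℕ) : ℝ≥0) + 1) • g j) := fun j =>
    ((hg j).isPolyLT (isAffineInvVal_onReal hfin μ.2.1 μ.2.2.2)).eq_sum
      (continuous_onReal_smul hfin μ.2.2.1 (hg' j)) t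
  simp only [hpoly, component_apply]
  refine tendsto_finsetSum _ fun k _ => Tendsto.const_smul (tendsto_finsetSum _ fun i _ =>
    Tendsto.const_smul ?_ _) _
  have := htend (((i : ℕ) : ℝ≥0) + 1) (by positivity)
  simpa using this

lemma component_mem [FiniteDimensional ℝ V] [T2Space F] (hC : C ⊆ Conv V) (hcone : IsCone C)
    (hfin : ConvFinite V ⊆ C) (μ : VConv C F) (k : Fin (Module.finrank ℝ V + 1)) :
    component hC hcone hfin μ k ∈ VConvHom C F (k : ℕ) := by
  intro f t ht hf
  rw [component_apply]
  refine vandermondeInv_smul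
    (c := fun i => t ^ (i : ℕ) • (component hC hcone hfin μ i).1 f) (fun j => ?_) k
  have := apply_scale_eq_sum hC hcone hfin μ f (t := (((j : ℕ) : ℝ) + 1) * t) (by positivity)
  simp only [scale_scale]
  rw [this]
  exact Finset.sum_congr rfl fun i _ => by rw [mul_pow, mul_smul]

lemma sum_component [FiniteDimensional ℝ V] [T2Space F] (hC : C ⊆ Conv V) (hcone : IsCone C)
    (hfin : ConvFinite V ⊆ C) (μ : VConv C F) : ∑ k, component hC hcone hfin μ k = μ := by
  ext f
  have := apply_scale_eq_sum hC hcone hfin μ f one_pos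
  simp only [scale_one, one_pow, one_smul] at this
  rw [Submodule.coe_sum, Finset.sum_apply]
  exact this.symm

lemma eq_zero_of_sum_eq_zero (hC : C ⊆ Conv V) (hcone : IsCone C) (hfin : ConvFinite V ⊆ C)
    {n : ℕ} (μ : Fin (n + 1) → VConv C F) (hμ : ∀ k : Fin (n + 1), μ k ∈ VConvHom C F (k : ℕ))
    (hsum : ∑ k, μ k = 0) (k : Fin (n + 1)) : μ k = 0 := by
  ext f
  have := vandermondeInv_smul (c := fun i => (μ i).1 f) (y := 0) (fun j => ?_) k
  · simpa using this.symm
  · have hj : (0 : ℝ) < ((j : ℕ) : ℝ) + 1 := by positivity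
    have h := congrFun (congrArg Subtype.val hsum) ⟨_, scale_mem hC hcone hfin f.2 hj⟩
    rw [Submodule.coe_sum, Finset.sum_apply] at h
    exact h.symm.trans (Finset.sum_congr rfl fun i _ => hμ i f _ hj _)

end Components

end ConvVal

theorem theorem1 {V : Type*} [NormedAddCommGroup V] [NormedSpace ℝ V] [FiniteDimensional ℝ V]
    {F : Type*} [AddCommGroup F] [Module ℝ F] [TopologicalSpace F] [IsTopologicalAddGroup F]
    [ContinuousSMul ℝ F] [T2Space F]
    (C : Set (V → EReal)) (hC : C ⊆ ConvVal.Conv V) (hcone : ConvVal.IsCone C)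
    (hfin : ConvVal.ConvFinite V ⊆ C) :
    DirectSum.IsInternal
      (fun i : Fin (Module.finrank ℝ V + 1) => ConvVal.VConvHom C F (i : ℕ)) := by
  classical
  have hcoe : ∀ x : DirectSum (Fin (Module.finrank ℝ V + 1)) fun i => ConvVal.VConvHom C F (i : ℕ),
      DirectSum.coeAddMonoidHom (fun i : Fin (Module.finrank ℝ V + 1) =>
        ConvVal.VConvHom C F (i : ℕ)) x = ∑ i, (x i : ConvVal.VConv C F) := fun x => by
    rw [DirectSum.coeAddMonoidHom_eq_dfinsuppSum, DFinsupp.sum_eq_sum_fintype _ (fun _ => rfl)]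
    rfl
  refine ⟨fun x y hxy => ?_, fun μ => ?_⟩
  · rw [hcoe, hcoe, ← sub_eq_zero, ← Finset.sum_sub_distrib] at hxy
    refine DFinsupp.ext fun i => Subtype.ext (sub_eq_zero.1 ?_)
    exact ConvVal.eq_zero_of_sum_eq_zero hC hcone hfin
      (fun i => (x i : ConvVal.VConv C F) - (y i : ConvVal.VConv C F))
      (fun i => Submodule.sub_mem _ (x i).2 (y i).2) hxy i
  · refine ⟨∑ k, DirectSum.of (fun i : Fin (Module.finrank ℝ V + 1) =>
      ConvVal.VConvHom C F (i : ℕ)) k ⟨_, ConvVal.component_mem hC hcone hfin μ k⟩, ?_⟩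
    simp only [map_sum, DirectSum.coeAddMonoidHom_of]
    exact ConvVal.sum_component hC hcone hfin μ
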